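/- Definitions. Let $G$ be a group. A set $S\subseteq G$ is elementary algebraic if there are an integer $n>0$, elements $a_1,\dots,a_n\in G$ and $\varepsilon_1,\dots,\varepsilon_n\in\{-1,1\}$ with $S=\{x\in G: x^{\varepsilon_1}a_1x^{\varepsilon_2}a_2\cdots a_{n-1}x^{\varepsilon_n}=a_n\}$. The Zariski topology $\mathfrak Z_G$ is the topology on $G$ whose closed sets are the intersections of finite unions of elementary algebraic sets. The Markov topology $\mathfrak M_G$ is the intersection of all Hausdorff group topologies on $G$; its closed sets are the sets that are closed in every Hausdorff group topology on $G$. A subgroup $K$ of $G$ is Markov embedded in $G$ if $\mathfrak M_K$ is the subspace topology induced on $K$ by $\mathfrak M_G$. For a set $X$, let $[X]^{\le\omega}$ be the family of all (at most) countable subsets of $X$; a family $\mathcal C\subseteq[X]^{\le\omega}$ is a club in $[X]^{\le\omega}$ if $\bigcup_{n\in\mathbb N}C_n\in\mathcal C$ whenever $C_0\subseteq C_1\subseteq\cdots$ are members of $\mathcal C$, and every $Y\in[X]^{\le\omega}$ is contained in some member of $\mathcal C$. Lemma. Let $\{G_i : i\in I\}$ be a family of (at most) countable groups, and let $G=\bigoplus_{i\in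 I}G_i$ be their direct sum, that is, the group, under pointwise operations, of all functions $g$ on $I$ with $g(i)\in G_i$ for all $i\in I$ and $\{i\in I: g(i)\ne 1\}$ finite. For $J\in[I]^{\le\omega}$ let $G_J=\bigoplus_{i\in J}G_i$, regarded as the subgroup of all $g\in G$ with $g(i)=1$ for every $i\in I\setminus J$. Let $H$ be a subgroup of $G$, and put $H_J=H\cap G_J$. If the family $\{J\in[I]^{\le\omega}: H_J \text{ is Markov embedded in } G_J\}$ contains a club in $[I]^{\le\omega}$, then $\mathfrak M_H=\mathfrak Z_H$. -/

import Mathlib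

/-- `S` is elementary algebraic: for some `n ≥ 0`, elements `a 0, …, a n` of `G` and signs
`ε 0, …, ε n`, it is the solution set of
`x ^ ε 0 * a 0 * x ^ ε 1 * a 1 * ⋯ * a (n - 1) * x ^ ε n = a n`. -/
def IsElementaryAlgebraic {G : Type*} [Group G] (S : Set G) : Prop :=
  ∃ (n : ℕ) (a : Fin (n + 1) → G) (ε : Fin (n + 1) → ℤˣ),
    S = {x : G |
      (List.ofFn fun i : Fin n => x ^ (ε i.castSucc : ℤ) * a i.castSucc).prod
        * x ^ (ε (Fin.last n) : ℤ) = a (Fin.last n)}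

/-- Finite (possibly empty) unions of elementary algebraic sets. -/
def IsFiniteUnionElementaryAlgebraic {G : Type*} [Group G] (S : Set G) : Prop :=
  ∃ F : Set (Set G), F.Finite ∧ (∀ E ∈ F, IsElementaryAlgebraic E) ∧ S = ⋃₀ F

/-- `S` is algebraic: an intersection of finite unions of elementary algebraic sets
(the empty intersection being the whole group). -/
def IsAlgebraicSubset {G : Type*} [Group G] (S : Set G) : Prop :=
  ∃ A : Set (Set G), (∀ T ∈ A, IsFiniteUnionElementaryAlgebraic T) ∧ S = ⋂₀ A

theorem isAlgebraicSubset_empty {G : Type*} [Group G] : IsAlgebraicSubset (∅ : Set G) :=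
  ⟨{∅}, by
    rintro T rfl
    exact ⟨∅, Set.finite_empty, by simp, by simp⟩, by simp⟩

theorem isAlgebraicSubset_sInter {G : Type*} [Group G] (A : Set (Set G))
    (hA : ∀ S ∈ A, IsAlgebraicSubset S) : IsAlgebraicSubset (⋂₀ A) := by
  refine ⟨{T | IsFiniteUnionElementaryAlgebraic T ∧ ⋂₀ A ⊆ T}, fun T hT => hT.1, ?_⟩
  apply Set.Subset.antisymm
  · exact Set.subset_sInter fun T hT => hT.2
  · refine Set.subset_sInter fun S hS => ?_
    obtain ⟨B, hB, rfl⟩ := hA S hS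
    refine Set.subset_sInter fun T hT => Set.sInter_subset_of_mem ⟨hB T hT, ?_⟩
    exact (Set.sInter_subset_of_mem hS).trans (Set.sInter_subset_of_mem hT)

theorem isAlgebraicSubset_union {G : Type*} [Group G] (S T : Set G)
    (hS : IsAlgebraicSubset S) (hT : IsAlgebraicSubset T) : IsAlgebraicSubset (S ∪ T) := by
  obtain ⟨A, hA, rfl⟩ := hS
  obtain ⟨B, hB, rfl⟩ := hT
  refine ⟨{R | ∃ P ∈ A, ∃ Q ∈ B, R = P ∪ Q}, ?_, ?_⟩
  · rintro R ⟨P, hP, Q, hQ, rfl⟩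
    obtain ⟨E, hE, hE', rfl⟩ := hA P hP
    obtain ⟨F, hF, hF', rfl⟩ := hB Q hQ
    refine ⟨E ∪ F, hE.union hF, ?_, Set.sUnion_union E F |>.symm⟩
    rintro K (hK | hK)
    exacts [hE' K hK, hF' K hK]
  · ext x
    constructor
    · rintro (hx | hx) R ⟨P, hP, Q, hQ, rfl⟩
      exacts [Or.inl (hx P hP), Or.inr (hx Q hQ)]
    · intro hx
      by_contra hcon
      simp only [Set.mem_union, Set.mem_sInter, not_or, not_forall] at hcon
      obtain ⟨⟨P, hP, hxP⟩, Q, hQ, hxQ⟩ := hcon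
      rcases hx _ ⟨P, hP, Q, hQ, rfl⟩ with h | h
      exacts [hxP h, hxQ h]

/-- The Zariski topology of a group: its closed sets are the algebraic sets. -/
def zariskiTopology (G : Type*) [Group G] : TopologicalSpace G :=
  TopologicalSpace.ofClosed {S | IsAlgebraicSubset S} isAlgebraicSubset_empty
    (fun A hA => isAlgebraicSubset_sInter A hA)
    (fun S hS T hT => isAlgebraicSubset_union S T hS hT)

theorem isClosed_zariskiTopology_iff {G : Type*} [Group G] (S : Set G) :
    @IsClosed G (zariskiTopology G) S ↔ IsAlgebraicSubset S := by
  rw [← @isOpen_compl_iff G S (zariskiTopology G)]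
  change IsAlgebraicSubset Sᶜᶜ ↔ _
  rw [compl_compl]

/-- `t` is a Hausdorff group topology on `G`. -/
def IsHausdorffGroupTopology {G : Type*} [Group G] (t : TopologicalSpace G) : Prop :=
  @IsTopologicalGroup G t _ ∧ @T2Space G t

/-- `S` is unconditionally closed: closed in every Hausdorff group topology on `G`. -/
def IsUnconditionallyClosed {G : Type*} [Group G] (S : Set G) : Prop :=
  ∀ t : TopologicalSpace G, IsHausdorffGroupTopology t → @IsClosed G t S

/-- The Markov topology of a group: the intersection of all Hausdorff group topologies. It is
written as `sSup` because Mathlib orders topologies by reverse inclusion of open sets. -/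
def markovTopology (G : Type*) [Group G] : TopologicalSpace G :=
  sSup {t | IsHausdorffGroupTopology t}

theorem isClosed_markovTopology_iff {G : Type*} [Group G] (S : Set G) :
    @IsClosed G (markovTopology G) S ↔ IsUnconditionallyClosed S := by
  unfold markovTopology IsUnconditionallyClosed
  rw [isClosed_sSup_iff]
  rfl

/-- `H` is Markov embedded in `G`: the Markov topology of the group `H` is the subspace topology
induced by the Markov topology of `G`. -/
def IsMarkovEmbedded {G : Type*} [Group G] (H : Subgroup G) : Prop :=
  markovTopology H = (markovTopology G).induced ((↑) : H → G)

/-- `C` is a club in the family of all countable subsets of `X`: it consists of countable sets, is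
closed under unions of increasing sequences, and is cofinal in the countable subsets of `X`. -/
structure IsClubOfCountableSets {X : Type*} (C : Set (Set X)) : Prop where
  countable : ∀ Y ∈ C, Y.Countable
  closed : ∀ s : ℕ → Set X, (∀ n, s n ∈ C) → Monotone s → (⋃ n, s n) ∈ C
  unbounded : ∀ Y : Set X, Y.Countable → ∃ Z ∈ C, Y ⊆ Z

/-- The direct sum of a family of groups: the functions `g` with `g i ∈ G i` for all `i` and
`g i ≠ 1` for only finitely many `i`, with pointwise operations. -/
def groupDirectSum {I : Type*} (G : I → Type*) [∀ i, Group (G i)] : Subgroup (∀ i, G i) where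
  carrier := {g | {i | g i ≠ 1}.Finite}
  one_mem' := by simp
  mul_mem' := by
    intro g h hg hh
    refine (Set.Finite.union hg hh).subset fun i hi => ?_
    by_contra hcon
    simp only [Set.mem_union, Set.mem_ofPred_eq, not_or, not_not] at hcon
    exact hi (by simp [hcon.1, hcon.2])
  inv_mem' := by
    intro g hg
    simpa using hg

/-- The direct sum of the `G i` with `i ∈ J`, as the subgroup of the full direct sum that consists
of the elements supported in `J`. -/
def directSumOn {I : Type*} (G : I → Type*) [∀ i, Group (G i)] (J : Set I) :
    Subgroup (groupDirectSum G) where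
  carrier := {g | ∀ i, i ∉ J → (g : ∀ i, G i) i = 1}
  one_mem' := fun _ _ => rfl
  mul_mem' := by
    intro g h hg hh i hi
    simp [hg i hi, hh i hi]
  inv_mem' := by
    intro g hg i hi
    simp [hg i hi]

/-! Algebraic sets are always unconditionally closed. For the converse, let `S` be unconditionally
closed in `H` and `x` in its Zariski closure: each finite system of inequations over `H` that holds
at `x` also holds at some point of `S`. Choose such witnesses. Closing off inside the club gives a
countable `J` with `H_J` Markov embedded in `G_J`, `x ∈ H_J`, and witnesses in `H_J` for all systems
over `H_J`. So `x` is in the Zariski closure of `S ∩ H_J` computed in `H_J`, and it suffices that `S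
∩ H_J` is algebraic there.

A Hausdorff group topology on the direct factor `G_J` extends to `G` by a discrete complement, and
restricts to `H`, where `S` is closed. Hence `S ∩ H_J` is the trace on `H_J` of its Zariski closure
in the countable group `G_J`: by `exists_hausdorffGroupTopology_mem_closure`, points of that closure
are limits of `S ∩ H_J` in some such topology. Markov embedding makes this trace unconditionally
closed in `H_J`, and Markov's theorem for the countable group `H_J` makes it algebraic.

Markov's theorem itself comes from building `y k ∈ A` such that `x⁻¹ * y k` tends to `1` in a
Hausdorff group topology, where `x` is in the Zariski closure of `A`. -/

/-! ### Words in one variable and algebraic sets -/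

/-- The value at `x` of the word `x ^ ε 0 * a 0 * x ^ ε 1 * a 1 * ⋯`. -/
def wordEval {G : Type*} [Group G] (L : List (ℤˣ × G)) (x : G) : G :=
  (L.map fun p => x ^ (p.1 : ℤ) * p.2).prod

/-- The solution set of a finite disjunction of equations between words and constants. -/
def solutionSet {G : Type*} [Group G] (F : List (List (ℤˣ × G) × G)) : Set G :=
  {x | ∃ e ∈ F, wordEval e.1 x = e.2}

/-- The functions given by words in one variable with constants. -/
def wordFunctions (G : Type*) [Group G] : Subgroup (G → G) :=
  Subgroup.closure ({id} ∪ Set.range (Function.const G))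

theorem IsElementaryAlgebraic.exists_wordEval {G : Type*} [Group G] {S : Set G}
    (hS : IsElementaryAlgebraic S) :
    ∃ e : List (ℤˣ × G) × G, ∀ x, x ∈ S ↔ wordEval e.1 x = e.2 := by
  obtain ⟨n, a, ε, rfl⟩ := hS
  refine ⟨(List.ofFn (fun i : Fin n => (ε i.castSucc, a i.castSucc)) ++ [(ε (Fin.last n), 1)],
    a (Fin.last n)), fun x => ?_⟩
  simp [wordEval, List.map_ofFn, Function.comp_def]

theorem isElementaryAlgebraic_wordEval {G : Type*} [Group G] (L : List (ℤˣ × G)) (ε : ℤˣ) (b : G) :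
    IsElementaryAlgebraic {x : G | wordEval L x * x ^ (ε : ℤ) = b} := by
  refine ⟨L.length, Fin.snoc (fun i => L[i].2) b, Fin.snoc (fun i => L[i].1) ε, ?_⟩
  ext x
  have h : wordEval L x = (List.ofFn fun i : Fin L.length => x ^ (L[i].1 : ℤ) * L[i].2).prod := by
    rw [wordEval]
    congr 1
    exact List.ext_getElem (by simp) (by simp)
  simp only [Fin.snoc_castSucc, Fin.snoc_last, Set.mem_ofPred_eq, h]

theorem IsElementaryAlgebraic.isAlgebraicSubset {G : Type*} [Group G] {S : Set G}
    (hS : IsElementaryAlgebraic S) : IsAlgebraicSubset S :=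
  ⟨{S}, by rintro T rfl; exact ⟨{T}, by simp, by simpa using hS, by simp⟩, by simp⟩

theorem isAlgebraicSubset_univ {G : Type*} [Group G] : IsAlgebraicSubset (Set.univ : Set G) :=
  ⟨∅, by simp, by simp⟩

theorem isAlgebraicSubset_setOf_wordEval_eq {G : Type*} [Group G] (L : List (ℤˣ × G)) (b : G) :
    IsAlgebraicSubset {x : G | wordEval L x = b} := by
  -- An elementary equation must contain `x` and end in a power of it. The empty word gives
  -- everything or nothing; otherwise the last constant moves to the right-hand side.
  rcases L.eq_nil_or_concat with rfl | ⟨L, ⟨ε, c⟩, rfl⟩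
  · by_cases hb : (1 : G) = b
    · simpa [wordEval, hb] using isAlgebraicSubset_univ
    · simpa [wordEval, hb] using isAlgebraicSubset_empty
  · convert (isElementaryAlgebraic_wordEval L ε (b * c⁻¹)).isAlgebraicSubset using 3 with x
    simp [wordEval, eq_mul_inv_iff_mul_eq, mul_assoc]

theorem isAlgebraicSubset_iUnion {G ι : Type*} [Group G] [Finite ι] {S : ι → Set G}
    (hS : ∀ i, IsAlgebraicSubset (S i)) : IsAlgebraicSubset (⋃ i, S i) := by
  let := zariskiTopology G
  rw [← isClosed_zariskiTopology_iff]
  exact isClosed_iUnion_of_finite fun i => (isClosed_zariskiTopology_iff _).2 (hS i)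

theorem isAlgebraicSubset_solutionSet {G : Type*} [Group G] (F : List (List (ℤˣ × G) × G)) :
    IsAlgebraicSubset (solutionSet F) := by
  have h : solutionSet F = ⋃ e : {e // e ∈ F}, {x | wordEval e.1.1 x = e.1.2} := by
    ext x; simp [solutionSet]
  have : Finite {e // e ∈ F} := F.finite_toSet.to_subtype
  rw [h]
  exact isAlgebraicSubset_iUnion fun e => isAlgebraicSubset_setOf_wordEval_eq _ _

theorem IsFiniteUnionElementaryAlgebraic.exists_solutionSet {G : Type*} [Group G] {S : Set G}
    (hS : IsFiniteUnionElementaryAlgebraic S) : ∃ F, S = solutionSet F := by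
  obtain ⟨F, hF, hE, rfl⟩ := hS
  choose! e he using fun E hEF => (hE E hEF).exists_wordEval
  refine ⟨hF.toFinset.toList.map e, ?_⟩
  ext x
  simp only [Set.mem_sUnion, solutionSet, List.mem_map, Finset.mem_toList, Set.Finite.mem_toFinset,
    Set.mem_ofPred_eq]
  constructor
  · rintro ⟨E, hEF, hx⟩
    exact ⟨_, ⟨E, hEF, rfl⟩, (he E hEF x).1 hx⟩
  · rintro ⟨_, ⟨E, hEF, rfl⟩, hx⟩
    exact ⟨E, hEF, (he E hEF x).2 hx⟩

theorem IsAlgebraicSubset.exists_solutionSet {G : Type*} [Group G] {S : Set G}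
    (hS : IsAlgebraicSubset S) {x : G} (hx : x ∉ S) : ∃ F, S ⊆ solutionSet F ∧ x ∉ solutionSet F := by
  obtain ⟨A, hA, rfl⟩ := hS
  obtain ⟨T, hT, hxT⟩ : ∃ T ∈ A, x ∉ T := by simpa using hx
  obtain ⟨F, rfl⟩ := (hA T hT).exists_solutionSet
  exact ⟨F, Set.sInter_subset_of_mem hT, hxT⟩

theorem IsAlgebraicSubset.isUnconditionallyClosed {G : Type*} [Group G] {S : Set G}
    (hS : IsAlgebraicSubset S) : IsUnconditionallyClosed S := by
  intro t ⟨_, _⟩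
  obtain ⟨A, hA, rfl⟩ := hS
  refine isClosed_sInter fun T hT => ?_
  obtain ⟨F, hF, hE, rfl⟩ := hA T hT
  rw [Set.sUnion_eq_biUnion]
  refine hF.isClosed_biUnion fun E hEF => ?_
  obtain ⟨e, he⟩ := (hE E hEF).exists_wordEval
  have : E = {x | wordEval e.1 x = e.2} := Set.ext he
  rw [this]
  refine isClosed_eq ?_ continuous_const
  exact continuous_list_prod _ fun p _ => (continuous_zpow _).mul continuous_const

theorem exists_eq_mul_wordEval {G : Type*} [Group G] {w : G → G} (hw : w ∈ wordFunctions G) :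
    ∃ c L, ∀ x, w x = c * wordEval L x := by
  induction hw using Subgroup.closure_induction_left with
  | one => exact ⟨1, [], by simp [wordEval]⟩
  | mul_left f hf w _ ih =>
    obtain ⟨c, L, h⟩ := ih
    rcases hf with rfl | ⟨d, rfl⟩
    · exact ⟨1, (1, c) :: L, fun x => by simp [wordEval, h, mul_assoc]⟩
    · exact ⟨d * c, L, fun x => by simp [h, mul_assoc]⟩
  | inv_mul_cancel f hf w _ ih =>
    obtain ⟨c, L, h⟩ := ih
    rcases hf with rfl | ⟨d, rfl⟩
    · exact ⟨1, (-1, c) :: L, fun x => by simp [wordEval, h, mul_assoc]⟩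
    · exact ⟨d⁻¹ * c, L, fun x => by simp [h, mul_assoc]⟩

theorem isAlgebraicSubset_setOf_eq {G : Type*} [Group G] {w : G → G} (hw : w ∈ wordFunctions G)
    (b : G) : IsAlgebraicSubset {x | w x = b} := by
  obtain ⟨c, L, h⟩ := exists_eq_mul_wordEval hw
  convert isAlgebraicSubset_setOf_wordEval_eq L (c⁻¹ * b) using 3 with x
  rw [h, eq_inv_mul_iff_mul_eq]

theorem id_mem_wordFunctions (G : Type*) [Group G] : id ∈ wordFunctions G :=
  Subgroup.subset_closure (by simp)

theorem const_mem_wordFunctions {G : Type*} [Group G] (c : G) :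
    Function.const G c ∈ wordFunctions G :=
  Subgroup.subset_closure (by simp)

/-- A point of the Zariski closure of `A` can be moved into `A` without violating any of finitely
many inequations that hold at this point. -/
theorem exists_mem_forall_word_ne {G : Type*} [Group G] {A : Set G} {x : G}
    (hx : ∀ T, IsAlgebraicSubset T → A ⊆ T → x ∈ T) {ι : Type*} [Finite ι] (w : ι → G → G)
    (b : ι → G) (hw : ∀ i, w i ∈ wordFunctions G) (hne : ∀ i, w i x ≠ b i) :
    ∃ y ∈ A, ∀ i, w i y ≠ b i := by
  by_contra! hcon
  have := hx (⋃ i, {y | w i y = b i}) (isAlgebraicSubset_iUnion fun i =>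
    isAlgebraicSubset_setOf_eq (hw i) _) fun y hy => by simpa using hcon y hy
  obtain ⟨i, hi⟩ := Set.mem_iUnion.1 this
  exact hne i hi

/-! ### Markov's theorem for countable groups -/

/-- The smallest family of sets `V n` such that `V n` contains `1` and `a k`, `(a k)⁻¹` for `n ≤ k`,
the products of two elements of `V (n + 1)`, and the conjugates of elements of `V (n + 1)` by
`g i` with `i ≤ n`. -/
inductive SmallWord {Γ : Type*} [Group Γ] (g a : ℕ → Γ) : ℕ → Γ → Prop
  | one (n : ℕ) : SmallWord g a n 1
  | gen {n k : ℕ} (h : n ≤ k) : SmallWord g a n (a k)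
  | gen_inv {n k : ℕ} (h : n ≤ k) : SmallWord g a n (a k)⁻¹
  | mul {n : ℕ} {x y : Γ} (hx : SmallWord g a (n + 1) x) (hy : SmallWord g a (n + 1) y) :
      SmallWord g a n (x * y)
  | conj {n i : ℕ} {x : Γ} (h : i ≤ n) (hx : SmallWord g a (n + 1) x) :
      SmallWord g a n (g i * x * (g i)⁻¹)

namespace SmallWord

variable {Γ Δ : Type*} [Group Γ] [Group Δ] {g a : ℕ → Γ} {n m : ℕ} {x : Γ}

theorem inv (h : SmallWord g a n x) : SmallWord g a n x⁻¹ := by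
  induction h with
  | one n => simpa using one n
  | gen h => exact gen_inv h
  | gen_inv h => simpa using gen h
  | mul _ _ ihx ihy => simpa using mul ihy ihx
  | conj h _ ih => simpa [mul_assoc] using conj h ih

theorem anti (hmn : m ≤ n) (h : SmallWord g a n x) : SmallWord g a m x := by
  induction hmn with
  | refl => exact h
  | step _ ih => exact ih (by simpa using mul h (one _))

theorem map (φ : Γ →* Δ) (h : SmallWord g a n x) : SmallWord (φ ∘ g) (φ ∘ a) n (φ x) := by
  induction h with
  | one n => simpa using one n
  | gen h => exact gen (a := φ ∘ a) h
  | gen_inv h => simpa using gen_inv (g := φ ∘ g) (a := φ ∘ a) h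
  | mul _ _ ihx ihy => simpa using mul ihx ihy
  | conj h _ ih => simpa using conj h ih

/-- Applied to evaluation of functions at a point, this lifts each small word to a word function, so
finitely many functions account for all values of the variable. -/
theorem exists_map_eq (φ : Γ →* Δ) {y : Δ} (h : SmallWord (φ ∘ g) (φ ∘ a) n y) :
    ∃ x, SmallWord g a n x ∧ φ x = y := by
  induction h with
  | one n => exact ⟨1, one n, map_one φ⟩
  | gen h => exact ⟨_, gen h, rfl⟩
  | gen_inv h => exact ⟨_, gen_inv h, map_inv φ _⟩
  | mul _ _ ihx ihy =>
    obtain ⟨x, hx, rfl⟩ := ihx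
    obtain ⟨y, hy, rfl⟩ := ihy
    exact ⟨x * y, mul hx hy, map_mul φ x y⟩
  | conj h _ ih =>
    obtain ⟨x, hx, rfl⟩ := ih
    exact ⟨_, conj h hx, by simp⟩

theorem mem_subgroup {K : Subgroup Γ} (hg : ∀ i, g i ∈ K) (ha : ∀ k, a k ∈ K)
    (h : SmallWord g a n x) : x ∈ K := by
  induction h with
  | one n => exact one_mem K
  | gen h => exact ha _
  | gen_inv h => exact inv_mem (ha _)
  | mul _ _ ihx ihy => exact mul_mem ihx ihy
  | conj h _ ih => exact mul_mem (mul_mem (hg _) ih) (inv_mem (hg _))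

theorem eq_one (ha : ∀ k, n ≤ k → a k = 1) (h : SmallWord g a n x) : x = 1 := by
  induction h with
  | one n => rfl
  | gen h => exact ha _ h
  | gen_inv h => rw [ha _ h, inv_one]
  | mul _ _ ihx ihy =>
    rw [ihx fun k hk => ha k (by lia), ihy fun k hk => ha k (by lia), one_mul]
  | conj h _ ih => rw [ih fun k hk => ha k (by lia), mul_one, mul_inv_cancel]

/-- Descending induction on `n`: `V n` is `{1}` for `N ≤ n`, and `V n` arises from `V (n + 1)` by
finitely many operations with finitely many generators. -/
theorem finite_setOf {N : ℕ} (ha : ∀ k, N ≤ k → a k = 1) (n : ℕ) :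
    {x | SmallWord g a n x}.Finite := by
  obtain ⟨d, hd⟩ : ∃ d, N ≤ n + d := ⟨N, by lia⟩
  induction d generalizing n with
  | zero =>
    exact (Set.finite_singleton 1).subset fun x hx => eq_one (fun k hk => ha k (by lia)) hx
  | succ d ih =>
    have hV := ih (n + 1) (by lia)
    have hA : (Set.range a).Finite := by
      refine (((Set.finite_Iio N).image a).union (Set.finite_singleton 1)).subset ?_
      rintro _ ⟨k, rfl⟩
      rcases lt_or_ge k N with hk | hk
      · exact Or.inl ⟨k, hk, rfl⟩
      · exact Or.inr (ha k hk)
    refine ((((Set.finite_singleton 1).union hA).union (hA.image (·⁻¹))).union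
      ((Set.Finite.image2 (· * ·) hV hV).union
        (Set.Finite.image2 (fun i x => g i * x * (g i)⁻¹) (Set.finite_Iic n) hV))).subset ?_
    rintro _ (_ | h | h | ⟨hx, hy⟩ | ⟨h, hx⟩)
    · exact Or.inl (Or.inl (Or.inl rfl))
    · exact Or.inl (Or.inl (Or.inr ⟨_, rfl⟩))
    · exact Or.inl (Or.inr ⟨_, ⟨_, rfl⟩, rfl⟩)
    · exact Or.inr (Or.inl ⟨_, hx, _, hy, rfl⟩)
    · exact Or.inr (Or.inr ⟨_, h, _, hx, rfl⟩)

/-- A small word only involves finitely many terms of the sequence. -/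
theorem exists_truncation (h : SmallWord g a n x) :
    ∃ N, ∀ M, N ≤ M → SmallWord g (fun k => if k < M then a k else 1) n x := by
  induction h with
  | one n => exact ⟨0, fun M _ => one n⟩
  | @gen n k h =>
    refine ⟨k + 1, fun M hM => ?_⟩
    simpa [show k < M by lia] using gen (g := g) (a := fun k => if k < M then a k else 1) h
  | @gen_inv n k h =>
    refine ⟨k + 1, fun M hM => ?_⟩
    simpa [show k < M by lia] using gen_inv (g := g) (a := fun k => if k < M then a k else 1) h
  | mul _ _ ihx ihy =>
    obtain ⟨N, hN⟩ := ihx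
    obtain ⟨N', hN'⟩ := ihy
    exact ⟨max N N', fun M hM => mul (hN M (by lia)) (hN' M (by lia))⟩
  | conj h _ ih =>
    obtain ⟨N, hN⟩ := ih
    exact ⟨N, fun M hM => conj h (hN M hM)⟩

end SmallWord

/-- If the sets `V n` of small words are separated from the nontrivial elements of `Γ`, then they
form a base of neighbourhoods of `1` in a Hausdorff group topology. -/
theorem exists_hausdorffGroupTopology_of_smallWord {Γ : Type*} [Group Γ] {g : ℕ → Γ}
    (hg : Function.Surjective g) (a : ℕ → Γ) (h : ∀ j, g j ≠ 1 → ¬ SmallWord g a j (g j)) :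
    ∃ t : TopologicalSpace Γ, IsHausdorffGroupTopology t ∧
      ∀ U ∈ @nhds Γ t 1, ∃ n, {x | SmallWord g a n x} ⊆ U := by
  let B : GroupFilterBasis Γ :=
    { sets := Set.range fun n => {x | SmallWord g a n x}
      nonempty := Set.range_nonempty _
      inter_sets := by
        rintro _ _ ⟨n, rfl⟩ ⟨m, rfl⟩
        exact ⟨_, ⟨max n m, rfl⟩, fun x hx => ⟨hx.anti (le_max_left _ _),
          hx.anti (le_max_right _ _)⟩⟩
      one' := by
        rintro _ ⟨n, rfl⟩
        exact .one n
      mul' := by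
        rintro _ ⟨n, rfl⟩
        refine ⟨_, ⟨n + 1, rfl⟩, ?_⟩
        rintro _ ⟨x, hx, y, hy, rfl⟩
        exact .mul hx hy
      inv' := by
        rintro _ ⟨n, rfl⟩
        exact ⟨_, ⟨n, rfl⟩, fun x hx => hx.inv⟩
      conj' := by
        rintro x₀ _ ⟨n, rfl⟩
        obtain ⟨i, rfl⟩ := hg x₀
        exact ⟨_, ⟨max n i + 1, rfl⟩, fun x hx =>
          (SmallWord.conj (le_max_right n i) hx).anti (le_max_left n i)⟩ }
  let := B.topology
  have hbasis := B.nhds_one_hasBasis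
  have hB (n : ℕ) : {x | SmallWord g a n x} ∈ B := ⟨n, rfl⟩
  refine ⟨B.topology, ⟨inferInstance, IsTopologicalGroup.t2Space_of_one_sep fun x hx => ?_⟩,
    fun U hU => ?_⟩
  · obtain ⟨j, rfl⟩ := hg x
    exact ⟨_, B.mem_nhds_one (hB j), h j hx⟩
  · obtain ⟨_, ⟨n, rfl⟩, hn⟩ := hbasis.mem_iff.1 hU
    exact ⟨n, hn⟩

/-- The inductive step: one more term is chosen without spoiling separation. If the new term is `x⁻¹
* y` with `y` variable, then `y = x` gives back the old sequence, so the required inequations hold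
at `x`; only finitely many matter, so they hold at some `y ∈ A`. -/
theorem exists_update_smallWord {Γ : Type*} [Group Γ] {A : Set Γ} {x : Γ}
    (hx : ∀ T, IsAlgebraicSubset T → A ⊆ T → x ∈ T) (g b : ℕ → Γ) {N : ℕ}
    (hb : ∀ k, N ≤ k → b k = 1) (h : ∀ j, g j ≠ 1 → ¬ SmallWord g b j (g j)) :
    ∃ y ∈ A, ∀ j, g j ≠ 1 → ¬ SmallWord g (Function.update b N (x⁻¹ * y)) j (g j) := by
  -- The same data in the group of functions of `y`: constants, except for the new term `y ↦ x⁻¹ *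
  -- y`.
  let gt : ℕ → Γ → Γ := fun i => Function.const Γ (g i)
  let p : Γ → Γ := fun y => x⁻¹ * y
  have hp : p ∈ wordFunctions Γ :=
    mul_mem (const_mem_wordFunctions x⁻¹) (id_mem_wordFunctions Γ)
  let bt : ℕ → Γ → Γ := Function.update (fun k => Function.const Γ (b k)) N p
  let ev (y : Γ) : (Γ → Γ) →* Γ := Pi.evalMonoidHom (fun _ => Γ) y
  have hgt (y : Γ) : ev y ∘ gt = g := rfl
  have hbt (y : Γ) : ev y ∘ bt = Function.update b N (x⁻¹ * y) := by
    ext k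
    by_cases hk : k = N
    · subst hk; simp [bt, ev, p]
    · simp [bt, ev, hk]
  have hbt1 : ∀ k, N + 1 ≤ k → bt k = 1 := by
    intro k hk
    have : k ≠ N := by lia
    ext y
    simp [bt, this, hb k (by lia)]
  have hfin (j : ℕ) : Finite {w | SmallWord gt bt j w} := SmallWord.finite_setOf hbt1 j
  have hmem {j : ℕ} {w : Γ → Γ} (hw : SmallWord gt bt j w) : w ∈ wordFunctions Γ := by
    refine hw.mem_subgroup (fun i => const_mem_wordFunctions _) fun k => ?_
    by_cases hk : k = N
    · subst hk; simpa [bt] using hp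
    · simpa [bt, hk] using const_mem_wordFunctions _
  have hne {j : ℕ} (hj : g j ≠ 1) {w : Γ → Γ} (hw : SmallWord gt bt j w) : w x ≠ g j := by
    intro heq
    have hwx : SmallWord (ev x ∘ gt) (ev x ∘ bt) j (w x) := hw.map (ev x)
    rw [hgt, hbt, inv_mul_cancel, ← hb N le_rfl, Function.update_eq_self, heq] at hwx
    exact h j hj hwx
  obtain ⟨y, hyA, hy⟩ := exists_mem_forall_word_ne hx
    (ι := Σ j : {j : Fin (N + 1) // g j ≠ 1}, {w | SmallWord gt bt j w})
    (fun i => i.2.1) (fun i => g i.1.1) (fun i => hmem i.2.2) (fun i => hne i.1.2 i.2.2)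
  refine ⟨y, hyA, fun j hj hw => ?_⟩
  rcases lt_or_ge j (N + 1) with hjN | hjN
  · rw [← hbt y] at hw
    obtain ⟨w, hw, hwj⟩ := SmallWord.exists_map_eq (g := gt) (ev y) hw
    exact hy ⟨⟨⟨j, hjN⟩, hj⟩, ⟨w, hw⟩⟩ hwj
  -- For `j > N` only terms of index at least `j` enter, and these are all `1`.
  · refine hj (hw.eq_one fun k hk => ?_)
    rw [Function.update_of_ne (by lia), hb k (by lia)]

/-- In a countable group, every point of the Zariski closure of a set lies in its closure with
respect to some Hausdorff group topology. -/
theorem exists_hausdorffGroupTopology_mem_closure {Γ : Type*} [Group Γ] [Countable Γ] {A : Set Γ}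
    {x : Γ} (hx : ∀ T, IsAlgebraicSubset T → A ⊆ T → x ∈ T) :
    ∃ t : TopologicalSpace Γ, IsHausdorffGroupTopology t ∧ x ∈ @closure Γ t A := by
  obtain ⟨g, hg⟩ := exists_surjective_nat Γ
  let State (N : ℕ) := {b : ℕ → Γ // (∀ k, N ≤ k → b k = 1) ∧
    ∀ j, g j ≠ 1 → ¬ SmallWord g b j (g j)}
  have step (N : ℕ) (b : State N) : ∃ y ∈ A, ∀ j, g j ≠ 1 →
      ¬ SmallWord g (Function.update b.1 N (x⁻¹ * y)) j (g j) :=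
    exists_update_smallWord hx g b.1 b.2.1 b.2.2
  choose y hyA hy using step
  let init : State 0 := ⟨fun _ => 1, fun _ _ => rfl, fun j hj h => hj (h.eq_one fun _ _ => rfl)⟩
  let next (N : ℕ) (b : State N) : State (N + 1) :=
    ⟨Function.update b.1 N (x⁻¹ * y N b), fun k hk => by
      rw [Function.update_of_ne (by lia), b.2.1 k (by lia)], hy N b⟩
  let s (N : ℕ) : State N := Nat.rec init next N
  let a (k : ℕ) : Γ := x⁻¹ * y k (s k)
  have hs (N : ℕ) : (s N).1 = fun k => if k < N then a k else 1 := by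
    induction N with
    | zero => rfl
    | succ N ih =>
      change Function.update (s N).1 N (a N) = _
      ext k
      rcases lt_trichotomy k N with hk | rfl | hk
      · simp [ih, hk, hk.ne, hk.trans (Nat.lt_succ_self N)]
      · simp
      · simp [ih, hk.ne', hk.not_gt, show ¬ k < N + 1 by lia]
  obtain ⟨t, ht, hU⟩ := exists_hausdorffGroupTopology_of_smallWord hg a fun j hj h => by
    -- A violation by the whole sequence would already occur at a finite stage.
    obtain ⟨N, hN⟩ := h.exists_truncation
    have := (s N).2.2 j hj
    rw [hs] at this
    exact this (hN N le_rfl)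
  refine ⟨t, ht, ?_⟩
  let := t
  have := ht.1
  rw [mem_closure_iff_nhds]
  intro U hUx
  have hU1 : (fun z => x * z) ⁻¹' U ∈ nhds (1 : Γ) :=
    (continuous_const_mul x).continuousAt.preimage_mem_nhds (by simpa using hUx)
  obtain ⟨n, hn⟩ := hU _ hU1
  refine ⟨y n (s n), ?_, hyA n (s n)⟩
  simpa [a] using hn (SmallWord.gen (g := g) (a := a) (le_refl n))

/-- Markov's theorem: in a countable group the unconditionally closed sets are algebraic. -/
theorem IsUnconditionallyClosed.isAlgebraicSubset {Γ : Type*} [Group Γ] [Countable Γ] {S : Set Γ}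
    (hS : IsUnconditionallyClosed S) : IsAlgebraicSubset S := by
  have : S = ⋂₀ {T | IsAlgebraicSubset T ∧ S ⊆ T} := by
    refine Set.Subset.antisymm (Set.subset_sInter fun T hT => hT.2) fun x hx => ?_
    obtain ⟨t, ht, hxt⟩ := exists_hausdorffGroupTopology_mem_closure (A := S) (x := x)
      fun T hT hST => hx T ⟨hT, hST⟩
    rwa [(hS t ht).closure_eq] at hxt
  rw [this]
  exact isAlgebraicSubset_sInter _ fun T hT => hT.1

/-! ### Traces on countable direct summands -/

theorem countable_setOf_finset_subset {X : Type*} {J : Set X} (hJ : J.Countable) :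
    {E : Finset X | ↑E ⊆ J}.Countable :=
  ((Set.countable_ofPred_finite_subset hJ).preimage Finset.coe_injective).mono fun E hE => by
    simpa using hE

/-- An unconditionally closed subset of `H` has closed trace for every topology on a subgroup `K` that
comes from a Hausdorff group topology on a direct factor of an ambient group of `H`. -/
theorem IsUnconditionallyClosed.mem_of_mem_closure_image {K H D E : Type*} [Group K] [Group H]
    [Group D] [Group E] {S : Set H} (hS : IsUnconditionallyClosed S) (ι : K →* H) (f : K →* D)
    (φ : H →* D × E) (hφ : Function.Injective φ) (hφι : ∀ k, φ (ι k) = (f k, 1))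
    {t : TopologicalSpace D} (ht : IsHausdorffGroupTopology t) {k : K}
    (hk : f k ∈ closure (f '' (ι ⁻¹' S))) : ι k ∈ S := by
  obtain ⟨_, _⟩ := ht
  -- The complementary factor is made discrete; `H` gets the topology induced from the product.
  let : TopologicalSpace E := ⊥
  have : DiscreteTopology E := ⟨rfl⟩
  let tH : TopologicalSpace H := .induced φ inferInstance
  have htH : IsHausdorffGroupTopology tH :=
    ⟨topologicalGroup_induced φ, .of_injective_continuous hφ continuous_induced_dom⟩
  rw [← (hS tH htH).closure_eq, closure_induced, hφι]
  have hc : Continuous fun d : D => (d, (1 : E)) := by fun_prop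
  refine closure_mono ?_ (image_closure_subset_closure_image hc ⟨_, hk, rfl⟩)
  rintro _ ⟨_, ⟨k', hk', rfl⟩, rfl⟩
  exact ⟨ι k', hk', hφι k'⟩

section DirectSum

variable {I : Type*} (G : I → Type*) [∀ i, Group (G i)]

/-- The projection of the direct sum onto the summands with index in `J`. -/
noncomputable def directSumProj (J : Set I) : groupDirectSum G →* directSumOn G J where
  toFun g := ⟨⟨fun i => open Classical in if i ∈ J then g.1 i else 1, by
    refine g.2.subset fun i hi => ?_
    by_contra h
    have h' : g.1 i = 1 := by simpa using h
    simp [h'] at hi⟩, fun i hi => by simp [hi]⟩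
  map_one' := by ext i; simp
  map_mul' g h := by
    ext i
    by_cases hi : i ∈ J <;> simp [hi]

theorem directSumProj_coe {J : Set I} (g : directSumOn G J) : directSumProj G J g = g := by
  ext i
  by_cases hi : i ∈ J
  · simp [directSumProj, hi]
  · simp [directSumProj, hi, g.2 i hi]

/-- The components of an element of the direct sum with index outside `J`. -/
def directSumRestrictCompl (J : Set I) : groupDirectSum G →* (∀ i : ↥Jᶜ, G i) where
  toFun g i := g.1 i
  map_one' := rfl
  map_mul' _ _ := rfl

theorem injective_directSumProj_prod (J : Set I) :
    Function.Injective ((directSumProj G J).prod (directSumRestrictCompl G J)) := by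
  intro g h hgh
  obtain ⟨h1, h2⟩ := Prod.ext_iff.1 hgh
  ext i
  by_cases hi : i ∈ J
  · simpa [directSumProj, hi] using congrArg (fun x : directSumOn G J => x.1.1 i) h1
  · exact congrFun h2 ⟨i, hi⟩

variable {G}

/-- The support of an element of the direct sum. -/
noncomputable def directSumSupport (g : groupDirectSum G) : Finset I :=
  Set.Finite.toFinset (s := {i | g.1 i ≠ 1}) g.2

theorem mem_directSumOn_iff {J : Set I} {g : groupDirectSum G} :
    g ∈ directSumOn G J ↔ ↑(directSumSupport g) ⊆ J := by
  have h (i : I) : i ∈ directSumSupport g ↔ g.1 i ≠ 1 :=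
    Set.Finite.mem_toFinset (s := {i | g.1 i ≠ 1}) g.2
  constructor
  · intro hg i hi
    by_contra hiJ
    exact (h i).1 hi (hg i hiJ)
  · intro hg i hi
    by_contra hne
    exact hi (hg ((h i).2 hne))

theorem countable_directSumOn [∀ i, Countable (G i)] {J : Set I} (hJ : J.Countable) :
    Countable (directSumOn G J) := by
  have hfin (E : Finset I) : (directSumOn G (E : Set I) : Set (groupDirectSum G)).Countable := by
    refine Set.countable_coe_iff.1 <| Function.Injective.countable
      (f := fun (g : directSumOn G (E : Set I)) (i : E) => g.1.1 i) fun g h hgh => ?_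
    ext i
    by_cases hi : i ∈ E
    · exact congrFun hgh ⟨i, hi⟩
    · rw [g.2 i hi, h.2 i hi]
  have hE : {E : Finset I | ↑E ⊆ J}.Countable := countable_setOf_finset_subset hJ
  refine ((hE.biUnion fun E _ => hfin E).mono fun g hg => ?_).to_subtype
  exact Set.mem_biUnion (x := directSumSupport g) (mem_directSumOn_iff.1 hg)
    (mem_directSumOn_iff.2 subset_rfl)

/-- The inclusion into `H` of its intersection with the direct sum over `J`. -/
def subgroupOfInclusion (H : Subgroup (groupDirectSum G)) (J : Set I) :
    H.subgroupOf (directSumOn G J) →* H where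
  toFun x := ⟨x.1.1, x.2⟩
  map_one' := rfl
  map_mul' _ _ := rfl

theorem mem_range_subgroupOfInclusion {H : Subgroup (groupDirectSum G)} {J : Set I} {h : H} :
    h ∈ (subgroupOfInclusion H J).range ↔ ↑(directSumSupport h.1) ⊆ J := by
  rw [← mem_directSumOn_iff]
  exact ⟨by rintro ⟨x, rfl⟩; exact x.1.2, fun hh => ⟨⟨⟨h.1, hh⟩, h.2⟩, rfl⟩⟩

/-- If `H ∩ G_J` is Markov embedded in the countable summand `G_J`, then the traces on it of the
unconditionally closed subsets of `H` are algebraic. -/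
theorem IsUnconditionallyClosed.isAlgebraicSubset_preimage [∀ i, Countable (G i)]
    {H : Subgroup (groupDirectSum G)} {J : Set I} (hJ : J.Countable)
    (hM : IsMarkovEmbedded (H.subgroupOf (directSumOn G J))) {S : Set H}
    (hS : IsUnconditionallyClosed S) :
    IsAlgebraicSubset (subgroupOfInclusion H J ⁻¹' S) := by
  have := countable_directSumOn (G := G) hJ
  let A : Set (directSumOn G J) :=
    (H.subgroupOf (directSumOn G J)).subtype '' (subgroupOfInclusion H J ⁻¹' S)
  let C : Set (directSumOn G J) := ⋂₀ {T | IsAlgebraicSubset T ∧ A ⊆ T}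
  have hC : IsUnconditionallyClosed C :=
    (isAlgebraicSubset_sInter _ fun T hT => hT.1).isUnconditionallyClosed
  have hCS : subgroupOfInclusion H J ⁻¹' S = Subtype.val ⁻¹' C := by
    refine Set.Subset.antisymm (fun k hk T hT => hT.2 ⟨k, hk, rfl⟩) fun k hk => ?_
    -- The topology must live on `G_J`, not just on `H_J`: it is `G_J` that is a direct factor.
    obtain ⟨t, ht, hkt⟩ := exists_hausdorffGroupTopology_mem_closure (A := A) (x := k.1)
      fun T hT hAT => hk T ⟨hT, hAT⟩
    refine hS.mem_of_mem_closure_image (subgroupOfInclusion H J)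
      (H.subgroupOf (directSumOn G J)).subtype
      (((directSumProj G J).prod (directSumRestrictCompl G J)).comp H.subtype)
      ((injective_directSumProj_prod G J).comp Subtype.val_injective) (fun k => ?_) ht hkt
    exact Prod.ext (directSumProj_coe G k.1) (funext fun i => k.1.2 i i.2)
  rw [hCS]
  refine IsUnconditionallyClosed.isAlgebraicSubset ?_
  let := markovTopology (directSumOn G J)
  rw [← isClosed_markovTopology_iff, hM, isClosed_induced_iff]
  exact ⟨C, (isClosed_markovTopology_iff C).2 hC, rfl⟩

end DirectSum

/-! ### Equations over subgroups and closing off in a club -/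

theorem map_wordEval {K H : Type*} [Group K] [Group H] (ι : K →* H) (L : List (ℤˣ × K)) (x : K) :
    wordEval (L.map (Prod.map id ι)) (ι x) = ι (wordEval L x) := by
  simp [wordEval, map_list_prod, Function.comp_def]

/-- The image under a homomorphism of a finite disjunction of equations. -/
def mapEquations {K H : Type*} [Group K] [Group H] (ι : K →* H)
    (F : List (List (ℤˣ × K) × K)) : List (List (ℤˣ × H) × H) :=
  F.map (Prod.map (List.map (Prod.map id ι)) ι)

theorem map_mem_solutionSet_iff {K H : Type*} [Group K] [Group H] {ι : K →* H}
    (hι : Function.Injective ι) {F : List (List (ℤˣ × K) × K)} {x : K} :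
    ι x ∈ solutionSet (mapEquations ι F) ↔ x ∈ solutionSet F := by
  simp [solutionSet, mapEquations, map_wordEval, hι.eq_iff, -Prod.exists]

/-- If a subgroup contains, for each finite system of inequations over it that `x` satisfies, an
element of `S` satisfying them, and if the trace of `S` on the subgroup is algebraic, then `x ∈ S`. -/
theorem map_mem_of_isAlgebraicSubset_preimage {K H : Type*} [Group K] [Group H] {ι : K →* H}
    (hι : Function.Injective ι) {S : Set H} {x : K}
    (h : ∀ F, ι x ∉ solutionSet (mapEquations ι F) →
      ∃ y, ι y ∈ S ∧ ι y ∉ solutionSet (mapEquations ι F))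
    (hS : IsAlgebraicSubset (ι ⁻¹' S)) : ι x ∈ S := by
  by_contra hx
  obtain ⟨F, hSF, hxF⟩ := hS.exists_solutionSet (x := x) hx
  obtain ⟨y, hyS, hyF⟩ := h F (by rwa [map_mem_solutionSet_iff hι])
  rw [map_mem_solutionSet_iff hι] at hyF
  exact hyF (hSF hyS)

/-- A club of countable sets has a member that is closed under a given countable-valued operation on
countable sets which is finitary. -/
theorem IsClubOfCountableSets.exists_mem_forall_subset {X : Type*} {C : Set (Set X)}
    (hC : IsClubOfCountableSets C) {f : Finset X → Set X} (hf : ∀ E, (f E).Countable) :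
    ∃ J ∈ C, ∀ E : Finset X, ↑E ⊆ J → f E ⊆ J := by
  have step (J : C) : ∃ J' : C, (J : Set X) ⊆ J' ∧ ∀ E : Finset X, ↑E ⊆ (J : Set X) →
      f E ⊆ (J' : Set X) := by
    have hE : {E : Finset X | ↑E ⊆ (J : Set X)}.Countable :=
      countable_setOf_finset_subset (hC.countable _ J.2)
    obtain ⟨Z, hZ, hsub⟩ := hC.unbounded _
      ((hC.countable _ J.2).union (hE.biUnion fun E _ => hf E))
    exact ⟨⟨Z, hZ⟩, Set.subset_union_left.trans hsub, fun E hEJ =>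
      (Set.subset_biUnion_of_mem (u := f) hEJ).trans (Set.subset_union_right.trans hsub)⟩
  choose next hnext hfnext using step
  obtain ⟨J₀, hJ₀, -⟩ := hC.unbounded ∅ Set.countable_empty
  let s (n : ℕ) : C := next^[n] ⟨J₀, hJ₀⟩
  have hs (n : ℕ) : s (n + 1) = next (s n) := Function.iterate_succ_apply' ..
  have hmono : Monotone fun n => (s n : Set X) :=
    monotone_nat_of_le_succ fun n => by rw [hs]; exact hnext _
  refine ⟨⋃ n, s n, hC.closed _ (fun n => (s n).2) hmono, fun E hE => ?_⟩
  -- A finite subset of the increasing union lies in one stage, and the next stage absorbs its image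
  -- under `f`.
  obtain ⟨n, hn⟩ := (directed_of_isDirected_le hmono).exists_mem_subset_of_finset_subset_biUnion hE
  have := hfnext (s n) E hn
  rw [← hs] at this
  exact this.trans (Set.subset_iUnion (fun n => (s n : Set X)) _)


/-- The constants of a finite list of equations. -/
def equationCoeffs {G : Type*} (F : List (List (ℤˣ × G) × G)) : List G :=
  F.flatMap fun e => e.2 :: e.1.map Prod.snd

theorem mem_range_mapEquations {K H : Type*} [Group K] [Group H] {ι : K →* H}
    {F : List (List (ℤˣ × H) × H)} :
    F ∈ Set.range (mapEquations ι) ↔ ∀ c ∈ equationCoeffs F, c ∈ ι.range := by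
  have h : mapEquations ι = List.map (Prod.map (List.map (Prod.map id ι)) ι) := rfl
  rw [h, Set.range_list_map]
  simp only [Set.range_prodMap, Set.range_list_map, Set.range_id, Set.mem_prod, Set.mem_univ,
    true_and, Set.mem_ofPred_eq, equationCoeffs, List.mem_flatMap, List.mem_cons, List.mem_map,
    MonoidHom.mem_range, Set.mem_range]
  constructor
  · rintro hF c ⟨e, he, rfl | ⟨p, hp, rfl⟩⟩
    · exact (hF e he).2
    · exact (hF e he).1 p hp
  · exact fun hF e he => ⟨fun p hp => hF _ ⟨e, he, .inr ⟨p, hp, rfl⟩⟩, hF _ ⟨e, he, .inl rfl⟩⟩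

theorem lemma4p8 {I : Type*} (G : I → Type*) [∀ i, Group (G i)] [∀ i, Countable (G i)]
    (H : Subgroup (groupDirectSum G))
    (hclub : ∃ C : Set (Set I), IsClubOfCountableSets C ∧
      C ⊆ {J : Set I | J.Countable ∧ IsMarkovEmbedded (H.subgroupOf (directSumOn G J))}) :
    markovTopology H = zariskiTopology H := by
  classical
  obtain ⟨C, hC, hCM⟩ := hclub
  refine TopologicalSpace.ext_isClosed fun S => ?_
  rw [isClosed_markovTopology_iff, isClosed_zariskiTopology_iff]
  refine ⟨fun hS => ?_, IsAlgebraicSubset.isUnconditionallyClosed⟩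
  suffices h : ⋂₀ {T | IsAlgebraicSubset T ∧ S ⊆ T} ⊆ S by
    rw [(Set.subset_sInter fun T hT => hT.2).antisymm h]
    exact isAlgebraicSubset_sInter _ fun T hT => hT.1
  intro x hx
  have hF (F : List (List (ℤˣ × H) × H)) (hxF : x ∉ solutionSet F) :
      ∃ y ∈ S, y ∉ solutionSet F := by
    by_contra! hcon
    exact hxF (hx _ ⟨isAlgebraicSubset_solutionSet F, hcon⟩)
  choose! y hyS hyF using hF
  -- There are countably many systems over the countable group `H_E`, so all their witnesses have
  -- countable total support. Systems that fail to exclude `x` contribute arbitrary values of `y`,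
  -- which is harmless.
  let f (E : Finset I) : Set I := directSumSupport x.1 ∪
    ⋃ F : List (List (ℤˣ × H.subgroupOf (directSumOn G (E : Set I))) × _),
      directSumSupport (y (mapEquations (subgroupOfInclusion H E) F)).1
  have hf (E : Finset I) : (f E).Countable := by
    have := countable_directSumOn (G := G) E.countable_toSet
    exact (Finset.countable_toSet _).union (Set.countable_iUnion fun F => Finset.countable_toSet _)
  obtain ⟨J, hJ, hfJ⟩ := hC.exists_mem_forall_subset hf
  have hι : Function.Injective (subgroupOfInclusion H J) := fun a b hab =>
    Subtype.ext (Subtype.ext (congrArg (fun h : H => h.1) hab))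
  obtain ⟨x, rfl⟩ : x ∈ (subgroupOfInclusion H J).range :=
    mem_range_subgroupOfInclusion.2 (Set.subset_union_left.trans (hfJ ∅ (by simp)))
  refine map_mem_of_isAlgebraicSubset_preimage hι (fun F hxF => ?_)
    (hS.isAlgebraicSubset_preimage (hCM hJ).1 (hCM hJ).2)
  -- A system over `H_J` has finitely many constants, so it is already a system over `H_E` for the
  -- finite union `E ⊆ J` of their supports; its witness is thus counted in `f E ⊆ J`.
  let E : Finset I := (equationCoeffs (mapEquations (subgroupOfInclusion H J) F)).toFinset.biUnion
    fun c => directSumSupport c.1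
  have hEJ : ↑E ⊆ J := by
    rw [Finset.coe_biUnion]
    refine Set.iUnion₂_subset fun c hc => mem_range_subgroupOfInclusion.1 ?_
    exact mem_range_mapEquations.1 ⟨F, rfl⟩ c (by simpa using hc)
  obtain ⟨F', hF'⟩ : mapEquations (subgroupOfInclusion H J) F ∈
      Set.range (mapEquations (subgroupOfInclusion H (E : Set I))) := by
    refine mem_range_mapEquations.2 fun c hc => mem_range_subgroupOfInclusion.2 ?_
    exact Finset.coe_subset.2 (Finset.subset_biUnion_of_mem (fun c : H => directSumSupport c.1)
      (List.mem_toFinset.2 hc))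
  obtain ⟨z, hz⟩ : y (mapEquations (subgroupOfInclusion H J) F) ∈
      (subgroupOfInclusion H J).range := by
    refine mem_range_subgroupOfInclusion.2 (Set.Subset.trans ?_ (hfJ E hEJ))
    rw [← hF']
    exact (Set.subset_iUnion (fun F' => (directSumSupport
      (y (mapEquations (subgroupOfInclusion H E) F')).1 : Set I)) F').trans Set.subset_union_right
  exact ⟨z, hz ▸ hyS _ hxF, hz ▸ hyF _ hxF⟩
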